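/- Let $\ell$ be an odd prime, $m$ a positive integer, and $\beta$ an integer. Then there are an even integer $k$ and a (holomorphic) modular form $f(\tau)=\sum_{n\ge 0}c(f;n)e^{2\pi i n\tau}$ of weight $k$ for $\mathrm{SL}_2(\mathbb{Z})$ whose Fourier coefficients are rational and $\ell$-integral (i.e. lie in the local ring $\mathbb{Z}_{(\ell)}$) such that, with $c(f;n):=0$ for $n<0$ and with congruences taken modulo $\ell\,\mathbb{Z}_{(\ell)}$, $$\forall n\in\mathbb{Z}:\ c(f;\,\ell^m n+\ell^{m-1}\beta)\equiv 0 \pmod{\ell}\qquad\text{and}\qquad \exists n\in\mathbb{Z}:\ c(f;\,\ell^{m-1}n)\not\equiv 0\pmod{\ell}.$$ In particular, this congruence is maximal: $\ell^m\mathbb{Z}+\ell^{m-1}\beta$ is maximal with respect to inclusion among all arithmetic progressions $M\mathbb{Z}+\beta'$ with $M>0$ and $\beta'$ integers such that $c(f;\,Mn+\beta')\equiv 0\pmod{\ell}$ for all $n\in\mathbb{Z}$. -/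

import Mathlib

open scoped MatrixGroups

/-- The Fourier coefficient `c(f; n)`, for an integer `n`, of a modular form
`f(τ) = ∑ c(f; n) e(nτ)` of level `1`; it vanishes for negative `n`. -/
noncomputable def modFourierCoeff {k : ℤ} (f : ModularForm 𝒮ℒ k) (n : ℤ) : ℂ :=
  if 0 ≤ n then (UpperHalfPlane.qExpansion 1 f).coeff n.toNat else 0

/-- A complex number is rational and `ℓ`-integral: it is a fraction of integers with denominator
prime to the prime number `ℓ`. -/
def IsRatLIntegral (ℓ : ℕ) (x : ℂ) : Prop :=
  ∃ a b : ℤ, ¬ (ℓ : ℤ) ∣ b ∧ x = (a : ℂ) / (b : ℂ)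

/-- The congruence `x ≡ y (mod ℓ)` in the ring of `ℓ`-integral rational numbers. -/
def CongrMod (ℓ : ℕ) (x y : ℂ) : Prop :=
  ∃ z : ℂ, IsRatLIntegral ℓ z ∧ x - y = (ℓ : ℂ) * z

/-- The arithmetic progression `M ℤ + β`. -/
def arithProg (M β : ℤ) : Set ℤ :=
  {N : ℤ | ∃ n : ℤ, N = M * n + β}

/-- `P` is an arithmetic progression `M ℤ + β` with `M > 0` on which `f` satisfies the
Ramanujan-type congruence `c(f; M n + β) ≡ 0 (mod ℓ)` for all integers `n`. -/
def HasRamanujanCongruence (ℓ : ℕ) {k : ℤ} (f : ModularForm 𝒮ℒ k) (P : Set ℤ) : Prop :=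
  ∃ M β : ℤ, 0 < M ∧ P = arithProg M β ∧
    ∀ n : ℤ, CongrMod ℓ (modFourierCoeff f (M * n + β)) 0

/-! If `g` has integral `q`-expansion `G`, then Frobenius gives `G ^ ℓ ^ r ≡ G(q ^ ℓ ^ r)` modulo
`ℓ`, so the coefficient of `g ^ ℓ ^ r` at `ℓ ^ r * n` is congruent to that of `g` at `n`
(`PowerSeries.dvd_intCoeff_pow_iff`). With `r = m - 1` this reduces everything to `m = 1`
(`exists_congruence_modulus_prime`).

For `ℓ ∤ β`, take `Δ ^ ℓ ≡ Δ(q ^ ℓ)`, supported on multiples of `ℓ`. For `ℓ ∣ β`, a form of weight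
`12 ℓ` has Serre derivative `θF - ℓ E₂ F ≡ θF`, with coefficients `n a(n)` that vanish at multiples
of `ℓ`.

Maximality holds because the modulus of a larger progression divides `ℓ ^ m`: a strictly larger one
contains `ℓ ^ (m - 1) ℤ`, where some coefficient is nonzero modulo `ℓ`. -/

open UpperHalfPlane ModularForm EisensteinSeries Derivative
open scoped ArithmeticFunction.sigma Manifold

/-! ### Power series -/

/-- The operator `q d/dq` on formal power series. -/
noncomputable def PowerSeries.theta {R : Type*} [Semiring R] (F : PowerSeries R) :
    PowerSeries R :=
  PowerSeries.mk fun n ↦ (n : R) * F.coeff n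

/-- The formal `q`-series `∑ σ_j(n) q ^ n`. -/
noncomputable def sigmaSeries (j : ℕ) : PowerSeries ℤ :=
  PowerSeries.mk fun n ↦ (σ j n : ℤ)

/-- Equivalent to `d ^ 5 ≡ d ^ 3` modulo 12; this is what makes the coefficients of `Δ` integral. -/
lemma twelve_dvd_pow_three_mul (d : ℤ) : (12 : ℤ) ∣ 5 * d ^ 3 + 7 * d ^ 5 := by
  apply Int.dvd_of_emod_eq_zero
  have h : d % 12 = 0 ∨ d % 12 = 1 ∨ d % 12 = 2 ∨ d % 12 = 3 ∨ d % 12 = 4 ∨ d % 12 = 5 ∨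
      d % 12 = 6 ∨ d % 12 = 7 ∨ d % 12 = 8 ∨ d % 12 = 9 ∨ d % 12 = 10 ∨ d % 12 = 11 := by omega
  rcases h with h | h | h | h | h | h | h | h | h | h | h | h <;>
    simp [pow_succ, Int.add_emod, Int.mul_emod, h]

lemma twelve_dvd_sigma (n : ℕ) : (12 : ℤ) ∣ 5 * (σ 3 n : ℤ) + 7 * (σ 5 n : ℤ) := by
  simp only [ArithmeticFunction.sigma_apply, Nat.cast_sum, Finset.mul_sum,
    ← Finset.sum_add_distrib]
  refine Finset.dvd_sum fun d _ ↦ ?_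
  push_cast
  exact twelve_dvd_pow_three_mul d

/-- The integral `q`-expansion of `Δ`, written in terms of divisor sums. -/
noncomputable def deltaSeries : PowerSeries ℤ :=
  PowerSeries.mk (fun n ↦ (5 * (σ 3 n : ℤ) + 7 * (σ 5 n : ℤ)) / 12) +
    100 * sigmaSeries 3 ^ 2 + 8000 * sigmaSeries 3 ^ 3 - 147 * sigmaSeries 5 ^ 2

lemma deltaSeries_identity :
    1728 * deltaSeries = (1 + 240 * sigmaSeries 3) ^ 3 - (1 - 504 * sigmaSeries 5) ^ 2 := by
  have h : 12 * PowerSeries.mk (fun n ↦ (5 * (σ 3 n : ℤ) + 7 * (σ 5 n : ℤ)) / 12) =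
      5 * sigmaSeries 3 + 7 * sigmaSeries 5 := by
    ext n
    have e (a : ℤ) (F : PowerSeries ℤ) : (PowerSeries.C a * F).coeff n = a * F.coeff n :=
      PowerSeries.coeff_C_mul n F a
    have h5 := e 5 (sigmaSeries 3)
    have h7 := e 7 (sigmaSeries 5)
    have h12 := e 12 (PowerSeries.mk (fun n ↦ (5 * (σ 3 n : ℤ) + 7 * (σ 5 n : ℤ)) / 12))
    simp only [map_ofNat] at h5 h7 h12
    rw [map_add, h5, h7, h12]
    simp only [sigmaSeries, PowerSeries.coeff_mk]
    exact Int.mul_ediv_cancel' (twelve_dvd_sigma n)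
  unfold deltaSeries
  -- `144 = 1728 / 12`; only the linear terms `720 σ₃ + 1008 σ₅` of the expansion need a division by
  -- 12.
  linear_combination 144 * h

lemma sigmaSeries_constantCoeff (j : ℕ) : PowerSeries.constantCoeff (sigmaSeries j) = 0 := by
  simp [sigmaSeries, ← PowerSeries.coeff_zero_eq_constantCoeff_apply]

lemma PowerSeries.coeff_one_mul_eq_zero {R : Type*} [CommRing R] {F G : PowerSeries R}
    (hF : PowerSeries.constantCoeff F = 0) (hG : PowerSeries.constantCoeff G = 0) :
    (F * G).coeff 1 = 0 := by
  simp [PowerSeries.coeff_mul, Finset.Nat.antidiagonal_succ, hF, hG]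

lemma deltaSeries_constantCoeff : PowerSeries.constantCoeff deltaSeries = 0 := by
  have h : PowerSeries.constantCoeff
      (PowerSeries.mk fun n ↦ (5 * (σ 3 n : ℤ) + 7 * (σ 5 n : ℤ)) / 12) = 0 := by
    rw [← PowerSeries.coeff_zero_eq_constantCoeff_apply, PowerSeries.coeff_mk]
    simp
  simp [deltaSeries, sigmaSeries_constantCoeff, h]

lemma deltaSeries_coeff_one : deltaSeries.coeff 1 = 1 := by
  have h3 := sigmaSeries_constantCoeff 3
  have h5 := sigmaSeries_constantCoeff 5
  have e1 : (100 * sigmaSeries 3 ^ 2 : PowerSeries ℤ).coeff 1 = 0 := by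
    rw [pow_two, ← mul_assoc]; exact PowerSeries.coeff_one_mul_eq_zero (by simp [h3]) h3
  have e2 : (8000 * sigmaSeries 3 ^ 3 : PowerSeries ℤ).coeff 1 = 0 := by
    rw [pow_succ, ← mul_assoc]; exact PowerSeries.coeff_one_mul_eq_zero (by simp [h3]) h3
  have e3 : (147 * sigmaSeries 5 ^ 2 : PowerSeries ℤ).coeff 1 = 0 := by
    rw [pow_two, ← mul_assoc]; exact PowerSeries.coeff_one_mul_eq_zero (by simp [h5]) h5
  simp only [deltaSeries, map_sub, map_add, e1, e2, e3]
  simp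

/-- Modulo a prime `p`, raising a power series to the power `p ^ r` is the substitution
`q ↦ q ^ (p ^ r)`. -/
lemma PowerSeries.coeff_pow_prime_pow (p : ℕ) [Fact p.Prime] (F : PowerSeries ℤ) (r n : ℕ) :
    ((F ^ p ^ r).coeff n : ZMod p) =
      if p ^ r ∣ n then (F.coeff (n / p ^ r) : ZMod p) else 0 := by
  have hp : p ^ r ≠ 0 := pow_ne_zero _ (Fact.out : p.Prime).ne_zero
  have hmap (G : PowerSeries ℤ) (i : ℕ) :
      (G.coeff i : ZMod p) = (G.map (Int.castRingHom (ZMod p))).coeff i := by simp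
  have key (G : PowerSeries (ZMod p)) : G ^ p ^ r = PowerSeries.expand (p ^ r) hp G := by
    -- Frobenius fixes the coefficients in `ZMod p`, so only the variable is raised to the power.
    have hid : iterateFrobenius (ZMod p) p r = RingHom.id _ := by
      ext x
      simp [iterateFrobenius_def, ZMod.pow_card_pow]
    have := MvPowerSeries.map_iterateFrobenius_expand p (Fact.out : p.Prime).ne_zero G r
    rw [hid, MvPowerSeries.map_id] at this
    exact this.symm
  rw [hmap, map_pow, key, PowerSeries.coeff_expand, hmap]

/-! ### The Serre derivative of a modular form of level one -/

section SerreDerivative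

variable {k : ℤ}

lemma hasSum_normalizedDeriv (f : ModularForm 𝒮ℒ k) (τ : ℍ) :
    HasSum (fun n ↦ (qExpansion 1 f).theta.coeff n • Function.Periodic.qParam 1 τ ^ n)
      (normalizedDerivOfComplex f τ) := by
  have hper := SlashInvariantFormClass.periodic_comp_ofComplex f
    (h := 1) one_mem_strictPeriods_SL
  have hball : DifferentiableOn ℂ (cuspFunction 1 f) (Metric.ball 0 1) :=
    differentiableOn_cuspFunction_ball one_pos hper (ModularFormClass.holo f)
      (ModularFormClass.bdd_at_infty f)
  set q := Function.Periodic.qParam 1 (τ : ℂ) with hqdef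
  have hq : q ∈ Metric.ball (0 : ℂ) 1 := by
    simpa using Function.Periodic.norm_qParam_lt_one one_pos τ.im_pos
  have hcomp : ((f : ℍ → ℂ) ∘ ofComplex) =
      cuspFunction 1 f ∘ Function.Periodic.qParam 1 := by
    ext z
    exact (Function.Periodic.eq_cuspFunction one_ne_zero hper z).symm
  have hqd : HasDerivAt (Function.Periodic.qParam 1) (2 * Real.pi * Complex.I * q) (τ : ℂ) := by
    have : HasDerivAt (fun z : ℂ ↦ Complex.exp (2 * Real.pi * Complex.I * z / (1 : ℝ)))
        (Complex.exp (2 * Real.pi * Complex.I * τ / (1 : ℝ)) *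
          (2 * Real.pi * Complex.I * 1 / (1 : ℝ))) (τ : ℂ) :=
      (((hasDerivAt_id (τ : ℂ)).const_mul _).div_const _).cexp
    convert! this using 1
    simp [hqdef, Function.Periodic.qParam]
    ring
  have hD : normalizedDerivOfComplex f τ = q * deriv (cuspFunction 1 f) q := by
    have h1 : HasDerivAt (cuspFunction 1 f) (deriv (cuspFunction 1 f) q)
        (Function.Periodic.qParam 1 (τ : ℂ)) :=
      (hball.differentiableAt (Metric.isOpen_ball.mem_nhds hq)).hasDerivAt
    rw [normalizedDerivOfComplex, hcomp, (h1.comp _ hqd).deriv]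
    field_simp [Complex.two_pi_I_ne_zero]
  have hT := (Complex.hasSum_taylorSeries_on_ball (hball.deriv Metric.isOpen_ball) hq).mul_left q
  rw [← hD] at hT
  -- Multiplying the Taylor series of the derivative by `q` shifts indices by one; the constant term
  -- of `theta` is zero.
  rw [← hasSum_nat_add_iff' 1]
  convert! hT using 1
  · ext n
    have hf : ((n.factorial : ℕ) : ℂ) ≠ 0 := by exact_mod_cast n.factorial_ne_zero
    have hn : (n : ℂ) + 1 ≠ 0 := by exact_mod_cast n.succ_ne_zero
    simp only [PowerSeries.theta, PowerSeries.coeff_mk, qExpansion_coeff, ← iteratedDeriv_succ',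
      Nat.factorial_succ, smul_eq_mul, sub_zero, pow_succ]
    push_cast
    field_simp
  · simp [PowerSeries.theta]

lemma isBoundedAtImInfty_serreDerivative (f : ModularForm 𝒮ℒ k) :
    IsBoundedAtImInfty (serreDerivative k f) := by
  have h1 : IsBoundedAtImInfty (normalizedDerivOfComplex f) :=
    isBoundedAtImInfty_of_hasSum_qExpansion one_pos (hasSum_normalizedDeriv f)
  have h2 : IsBoundedAtImInfty (E2 * (f : ℍ → ℂ)) :=
    isBoundedAtImInfty_E2.mul (ModularFormClass.bdd_at_infty f)
  have h3 := h1.sub (h2.smul (k * 12⁻¹ : ℂ))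
  refine (congrArg IsBoundedAtImInfty ?_).mpr h3
  ext z
  simp [serreDerivative_apply, mul_assoc]

/-- The Serre derivative of a modular form of level one and weight `k`, as a modular form of
weight `k + 2`. -/
noncomputable def ModularForm.serreDeriv (f : ModularForm 𝒮ℒ k) : ModularForm 𝒮ℒ (k + 2) where
  toFun := serreDerivative k f
  slash_action_eq' _ hγ := by
    obtain ⟨γ, rfl⟩ := hγ
    exact serreDerivative_slash_invariant (ModularFormClass.holo f)
      (SlashInvariantForm.slash_action_eqn f _ ⟨γ, rfl⟩)
  holo' := serreDerivative_mdifferentiable k (ModularFormClass.holo f)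
  bdd_at_cusps' hc := by
    rw [Subgroup.IsArithmetic.isCusp_iff_isCusp_SL2Z] at hc
    rw [OnePoint.isBoundedAt_iff_forall_SL2Z hc]
    -- Slash invariance moves every cusp to infinity.
    intro γ _
    have := serreDerivative_slash_invariant (γ := γ) (ModularFormClass.holo f)
      (SlashInvariantForm.slash_action_eqn f _ ⟨γ, rfl⟩)
    change IsBoundedAtImInfty (serreDerivative k f ∣[k + 2] γ)
    rw [this]
    exact isBoundedAtImInfty_serreDerivative f

lemma hasSum_mul_qSeries {A B : PowerSeries ℂ} {q a b : ℂ}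
    (hA : HasSum (fun n ↦ A.coeff n • q ^ n) a) (hB : HasSum (fun n ↦ B.coeff n • q ^ n) b) :
    HasSum (fun n ↦ (A * B).coeff n • q ^ n) (a * b) := by
  have e : (fun n ↦ (A * B).coeff n • q ^ n) = fun n ↦ ∑ i ∈ Finset.HasAntidiagonal.antidiagonal n,
      (A.coeff i.1 • q ^ i.1) * (B.coeff i.2 • q ^ i.2) := by
    ext n
    rw [PowerSeries.coeff_mul, Finset.sum_smul]
    refine Finset.sum_congr rfl fun i hi ↦ ?_
    rw [← Finset.HasAntidiagonal.mem_antidiagonal.mp hi, pow_add]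
    simp only [smul_eq_mul]
    ring
  rw [e, ← hA.tsum_eq, ← hB.tsum_eq,
    tsum_mul_tsum_eq_tsum_sum_antidiagonal_of_summable_norm hA.summable.norm hB.summable.norm]
  exact (summable_norm_sum_mul_antidiagonal_of_summable_norm hA.summable.norm
    hB.summable.norm).of_norm.hasSum

/-- `E₂ = 1 - 24 ∑ σ₁(n) q ^ n` as an integral power series. -/
noncomputable def e2Series : PowerSeries ℤ := 1 - 24 * sigmaSeries 1

lemma map_sigmaSeries_coeff (c : ℤ) (j n : ℕ) :
    ((1 + PowerSeries.C c * sigmaSeries j).map (Int.castRingHom ℂ)).coeff n =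
      if n = 0 then 1 else c * (σ j n : ℂ) := by
  rw [PowerSeries.coeff_map, map_add, PowerSeries.coeff_C_mul, PowerSeries.coeff_one]
  rcases eq_or_ne n 0 with rfl | hn
  · simp [sigmaSeries]
  · simp [hn, sigmaSeries]

lemma qExpansion_serreDeriv (f : ModularForm 𝒮ℒ k) :
    qExpansion 1 f.serreDeriv = (qExpansion 1 f).theta -
      PowerSeries.C (k / 12 : ℂ) * (e2Series.map (Int.castRingHom ℂ) * qExpansion 1 f) := by
  ext n
  refine (ModularFormClass.qExpansion_coeff_unique (f := f.serreDeriv) one_pos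
    one_mem_strictPeriods_SL (c := fun n ↦ ((qExpansion 1 f).theta - PowerSeries.C (k / 12 : ℂ) *
      (e2Series.map (Int.castRingHom ℂ) * qExpansion 1 f)).coeff n) (fun τ ↦ ?_) n).symm
  have hE : HasSum (fun n ↦ (e2Series.map (Int.castRingHom ℂ)).coeff n •
      Function.Periodic.qParam 1 τ ^ n) (E2 τ) := by
    have := hasSum_qExpansion_E2 (z := τ)
    have e : e2Series = 1 + PowerSeries.C (-24) * sigmaSeries 1 := by
      simp [e2Series, sub_eq_add_neg]
    simp only [e, map_sigmaSeries_coeff]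
    simpa only [Function.Periodic.qParam, Complex.ofReal_one, div_one, Int.cast_neg,
      Int.cast_ofNat] using this
  have hf : HasSum (fun n ↦ (qExpansion 1 f).coeff n • Function.Periodic.qParam 1 τ ^ n) (f τ) :=
    ModularForm.hasSum_qExpansion f one_pos one_mem_strictPeriods_SL τ
  have := (hasSum_normalizedDeriv f τ).sub ((hasSum_mul_qSeries hE hf).mul_left (k / 12 : ℂ))
  convert! this using 1
  · ext n
    simp only [map_sub, PowerSeries.coeff_C_mul, smul_eq_mul]
    ring
  · change serreDerivative k f τ = _
    rw [serreDerivative_apply]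
    ring

end SerreDerivative

/-! ### Integral `q`-expansions -/

/-- The `q`-expansion of `f` is the integral power series `F`. -/
def HasIntegralExpansion {k : ℤ} (f : ModularForm 𝒮ℒ k) (F : PowerSeries ℤ) : Prop :=
  qExpansion 1 f = F.map (Int.castRingHom ℂ)

namespace HasIntegralExpansion

variable {k l : ℤ} {f : ModularForm 𝒮ℒ k} {g : ModularForm 𝒮ℒ l} {F G : PowerSeries ℤ}

lemma mul (hf : HasIntegralExpansion f F) (hg : HasIntegralExpansion g G) :
    HasIntegralExpansion (f.mul g) (F * G) := by
  rw [HasIntegralExpansion, ModularForm.qExpansion_mul one_pos one_mem_strictPeriods_SL, hf, hg,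
    map_mul]

lemma pow (hf : HasIntegralExpansion f F) (n : ℕ) : HasIntegralExpansion (f.pow n) (F ^ n) := by
  rw [HasIntegralExpansion, ModularForm.qExpansion_pow one_pos one_mem_strictPeriods_SL, hf,
    map_pow]

/-- Weight divisible by 12 keeps `k / 12` integral; `c = ℓ` later removes the `E₂` term modulo `ℓ`.
-/
lemma serreDeriv (hf : HasIntegralExpansion f F) {c : ℤ} (hc : k = 12 * c) :
    HasIntegralExpansion f.serreDeriv (F.theta - PowerSeries.C c * (e2Series * F)) := by
  have h : ((k : ℂ) / 12) = (c : ℤ) := by rw [hc]; push_cast; ring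
  have hθ : (F.map (Int.castRingHom ℂ)).theta = F.theta.map (Int.castRingHom ℂ) := by
    ext n
    simp [PowerSeries.theta]
  rw [HasIntegralExpansion, qExpansion_serreDeriv, hf, hθ, h]
  simp

end HasIntegralExpansion

/-- The integral `q`-expansion of `E₄`. -/
noncomputable def e4Series : PowerSeries ℤ := 1 + 240 * sigmaSeries 3

lemma hasIntegralExpansion_E₄ : HasIntegralExpansion E₄ e4Series := by
  have e : e4Series = 1 + PowerSeries.C 240 * sigmaSeries 3 := by simp [e4Series]
  ext n
  rw [e, map_sigmaSeries_coeff, E_qExpansion_coeff _ ⟨2, rfl⟩]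
  norm_num [show bernoulli 4 = -1 / 30 by decide +kernel]

lemma hasIntegralExpansion_E₆ : HasIntegralExpansion E₆ (1 - 504 * sigmaSeries 5) := by
  have e : 1 - 504 * sigmaSeries 5 = 1 + PowerSeries.C (-504) * sigmaSeries 5 := by
    simp [sub_eq_add_neg]
  rw [e]
  ext n
  rw [map_sigmaSeries_coeff, E_qExpansion_coeff _ ⟨3, rfl⟩]
  norm_num [show bernoulli 6 = 1 / 42 by decide +kernel]

/-- The discriminant `Δ = (E₄³ - E₆²) / 1728`, as a modular form. -/
noncomputable def deltaForm : ModularForm 𝒮ℒ 12 :=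
  (1728 : ℂ)⁻¹ •
    (ModularForm.mcast (by decide) (E₄.pow 3) - ModularForm.mcast (by decide) (E₆.pow 2))

lemma hasIntegralExpansion_deltaForm : HasIntegralExpansion deltaForm deltaSeries := by
  have h : PowerSeries.C 1728 * deltaSeries.map (Int.castRingHom ℂ) =
      (e4Series.map (Int.castRingHom ℂ)) ^ 3 -
        ((1 - 504 * sigmaSeries 5).map (Int.castRingHom ℂ)) ^ 2 := by
    rw [← map_pow, ← map_pow, ← map_sub, e4Series, ← deltaSeries_identity, map_mul,
      map_ofNat, map_ofNat]
  rw [← hasIntegralExpansion_E₄, ← hasIntegralExpansion_E₆,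
    ← ModularForm.qExpansion_pow one_pos one_mem_strictPeriods_SL,
    ← ModularForm.qExpansion_pow one_pos one_mem_strictPeriods_SL] at h
  have e : qExpansion 1 deltaForm = (1728 : ℂ)⁻¹ • (PowerSeries.C 1728 *
      deltaSeries.map (Int.castRingHom ℂ)) := by
    rw [h]
    refine (ModularForm.qExpansion_smul one_pos one_mem_strictPeriods_SL (1728 : ℂ)⁻¹
      (ModularForm.mcast (by decide) (E₄.pow 3) - ModularForm.mcast (by decide) (E₆.pow 2) :
        ModularForm 𝒮ℒ 12)).trans ?_
    congr 1
    exact ModularForm.qExpansion_sub one_pos one_mem_strictPeriods_SL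
      (ModularForm.mcast (by decide) (E₄.pow 3)) (ModularForm.mcast (by decide) (E₆.pow 2))
  rw [HasIntegralExpansion, e]
  ext n
  rw [PowerSeries.coeff_smul, PowerSeries.coeff_C_mul]
  simp

/-! ### Coefficients at integers and congruences -/

/-- The coefficient at an integer, zero at negative integers. -/
noncomputable def PowerSeries.intCoeff (F : PowerSeries ℤ) (n : ℤ) : ℤ :=
  if 0 ≤ n then F.coeff n.toNat else 0

lemma HasIntegralExpansion.modFourierCoeff_eq {k : ℤ} {f : ModularForm 𝒮ℒ k} {F : PowerSeries ℤ}
    (hf : HasIntegralExpansion f F) (n : ℤ) : modFourierCoeff f n = (F.intCoeff n : ℤ) := by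
  rw [modFourierCoeff, PowerSeries.intCoeff, hf]
  split_ifs <;> simp

lemma isRatLIntegral_intCast {ℓ : ℕ} (hℓ : ℓ.Prime) (a : ℤ) : IsRatLIntegral ℓ a :=
  ⟨a, 1, fun h ↦ hℓ.one_lt.ne' (by simpa using Int.natAbs_dvd_natAbs.mpr h), by simp⟩

lemma congrMod_intCast_zero_iff {ℓ : ℕ} (hℓ : ℓ.Prime) (a : ℤ) :
    CongrMod ℓ a 0 ↔ (ℓ : ℤ) ∣ a := by
  constructor
  · rintro ⟨z, ⟨c, b, hb, rfl⟩, h⟩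
    have hb0 : (b : ℂ) ≠ 0 := by
      rintro h0
      exact hb (by simp [Int.cast_eq_zero.mp h0])
    have h' : a * b = ℓ * c := by
      rw [sub_zero] at h
      field_simp at h
      exact_mod_cast h
    exact ((Nat.prime_iff_prime_int.mp hℓ).dvd_or_dvd ⟨c, h'⟩).resolve_right hb
  · rintro ⟨c, rfl⟩
    exact ⟨c, isRatLIntegral_intCast hℓ c, by push_cast; ring⟩

lemma PowerSeries.dvd_intCoeff_pow_iff {p : ℕ} (hp : p.Prime) (F : PowerSeries ℤ) (r : ℕ)
    (n : ℤ) : (p : ℤ) ∣ (F ^ p ^ r).intCoeff ((p : ℤ) ^ r * n) ↔ (p : ℤ) ∣ F.intCoeff n := by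
  have : Fact p.Prime := ⟨hp⟩
  have hpos : 0 < p ^ r := pow_pos hp.pos r
  rcases le_or_gt 0 n with hn | hn
  · lift n to ℕ using hn
    have e : (p : ℤ) ^ r * n = ((p ^ r * n : ℕ) : ℤ) := by push_cast; ring
    rw [e, intCoeff, intCoeff, if_pos (Int.natCast_nonneg _), if_pos (Int.natCast_nonneg _),
      Int.toNat_natCast, Int.toNat_natCast, ← ZMod.intCast_zmod_eq_zero_iff_dvd,
      ← ZMod.intCast_zmod_eq_zero_iff_dvd, coeff_pow_prime_pow, if_pos (dvd_mul_right _ _),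
      Nat.mul_div_cancel_left _ hpos]
  · have h : (p : ℤ) ^ r * n < 0 := mul_neg_of_pos_of_neg (by exact_mod_cast hpos) hn
    rw [intCoeff, intCoeff, if_neg h.not_ge, if_neg hn.not_ge]

/-! ### Congruences of modulus `ℓ` -/

/-- For every residue class `β` modulo `ℓ` there is a form with integral coefficients, nonzero
modulo `ℓ`, whose coefficients in the class `β` vanish modulo `ℓ`. It is `Δ ^ ℓ` if `ℓ ∤ β`, and
the Serre derivative of `Δ E₄ ^ (3 ℓ - 3)`, congruent to the `q d/dq`-derivative, if `ℓ ∣ β`. -/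
lemma exists_congruence_modulus_prime {ℓ : ℕ} (hℓ : ℓ.Prime) (β : ℤ) :
    ∃ (k : ℤ) (f : ModularForm 𝒮ℒ k) (F : PowerSeries ℤ), Even k ∧ HasIntegralExpansion f F ∧
      (∀ n : ℕ, (ℓ : ℤ) ∣ n - β → (ℓ : ℤ) ∣ F.coeff n) ∧ ∃ n : ℕ, ¬ (ℓ : ℤ) ∣ F.coeff n := by
  have : Fact ℓ.Prime := ⟨hℓ⟩
  have h1 : ¬ (ℓ : ℤ) ∣ 1 := fun h ↦
    hℓ.one_lt.ne' (by simpa using Int.natAbs_dvd_natAbs.mpr h)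
  by_cases hβ : (ℓ : ℤ) ∣ β
  · have hG := hasIntegralExpansion_deltaForm.mul (hasIntegralExpansion_E₄.pow (3 * ℓ - 3))
    -- The exponent `3 * ℓ - 3` is chosen to bring the weight to `12 ℓ`; since `E₄` has constant
    -- term 1, the coefficient of `q` stays 1.
    have hw : (12 : ℤ) + ((3 * ℓ - 3 : ℕ) : ℤ) * 4 = 12 * (ℓ : ℤ) := by
      have := hℓ.one_lt
      omega
    refine ⟨_, _, _, ?_, hG.serreDeriv hw, fun n hn ↦ ?_, 1, fun h ↦ h1 ?_⟩
    · rw [hw]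
      exact ⟨6 * ℓ + 1, by ring⟩
    · rw [map_sub, PowerSeries.coeff_C_mul, PowerSeries.theta, PowerSeries.coeff_mk]
      exact dvd_sub (((dvd_sub_left hβ).mp hn).mul_right _) (dvd_mul_right _ _)
    · have hc : (deltaSeries * e4Series ^ (3 * ℓ - 3)).coeff 1 = 1 := by
        simp [PowerSeries.coeff_mul, Finset.Nat.antidiagonal_succ, deltaSeries_constantCoeff,
          deltaSeries_coeff_one, e4Series, sigmaSeries_constantCoeff]
      rw [map_sub, PowerSeries.coeff_C_mul, PowerSeries.theta, PowerSeries.coeff_mk, hc] at h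
      simpa using (dvd_sub_left (dvd_mul_right _ _)).mp h
  · refine ⟨_, _, _, ?_, hasIntegralExpansion_deltaForm.pow (ℓ ^ 1), fun n hn ↦ ?_, ℓ, ?_⟩
    · exact ⟨6 * (ℓ ^ 1 : ℕ), by ring⟩
    · rw [← ZMod.intCast_zmod_eq_zero_iff_dvd, PowerSeries.coeff_pow_prime_pow, if_neg]
      rw [pow_one]
      exact fun h ↦ hβ ((dvd_sub_right (Int.natCast_dvd_natCast.mpr h)).mp hn)
    · rw [← ZMod.intCast_zmod_eq_zero_iff_dvd, PowerSeries.coeff_pow_prime_pow, pow_one,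
        if_pos dvd_rfl, Nat.div_self hℓ.pos, deltaSeries_coeff_one]
      simp

/-! ### Maximality -/

/-- A progression that contains `ℓ ^ (r + 1) ℤ + ℓ ^ r β` is equal to it or contains
`ℓ ^ r ℤ`. -/
lemma arithProg_subset_or_of_superset {ℓ : ℕ} (hℓ : ℓ.Prime) (r : ℕ) (β M β' : ℤ)
    (hM : 0 < M)
    (h : arithProg ((ℓ : ℤ) ^ (r + 1)) ((ℓ : ℤ) ^ r * β) ⊆ arithProg M β') :
    arithProg M β' ⊆ arithProg ((ℓ : ℤ) ^ (r + 1)) ((ℓ : ℤ) ^ r * β) ∨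
      ∀ n : ℤ, (ℓ : ℤ) ^ r * n ∈ arithProg M β' := by
  obtain ⟨a, ha⟩ := h ⟨0, rfl⟩
  obtain ⟨b, hb⟩ := h ⟨1, rfl⟩
  -- Two consecutive terms of the smaller progression differ by a multiple of `M`.
  have hdvd : M ∣ (ℓ : ℤ) ^ (r + 1) := ⟨b - a, by linear_combination hb - ha⟩
  obtain ⟨i, hi, hMi⟩ : ∃ i ≤ r + 1, M = (ℓ : ℤ) ^ i := by
    lift M to ℕ using hM.le
    obtain ⟨i, hi, h⟩ := (Nat.dvd_prime_pow hℓ).mp (by exact_mod_cast hdvd)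
    exact ⟨i, hi, by exact_mod_cast h⟩
  rcases hi.eq_or_lt with rfl | hlt
  · left
    rintro N ⟨n, rfl⟩
    exact ⟨n - a, by linear_combination (n - a) * hMi - ha⟩
  · right
    intro n
    -- As `M ∣ ℓ ^ r`, the class of `ℓ ^ r * β` modulo `M` contains all multiples of `ℓ ^ r`.
    obtain ⟨c, hc⟩ : M ∣ (ℓ : ℤ) ^ r := hMi ▸ pow_dvd_pow _ (Nat.lt_succ_iff.mp hlt)
    exact ⟨c * (n - β) + a, by linear_combination (n - β) * hc + ha⟩

theorem mainTheorem9 (ℓ : ℕ) (hℓ : ℓ.Prime) (hodd : Odd ℓ) (m : ℕ) (hm : 0 < m) (β : ℤ) :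
    ∃ (k : ℤ) (f : ModularForm 𝒮ℒ k), Even k ∧
      (∀ n : ℤ, IsRatLIntegral ℓ (modFourierCoeff f n)) ∧
      (∀ n : ℤ,
        CongrMod ℓ (modFourierCoeff f ((ℓ : ℤ) ^ m * n + (ℓ : ℤ) ^ (m - 1) * β)) 0) ∧
      (∃ n : ℤ, ¬ CongrMod ℓ (modFourierCoeff f ((ℓ : ℤ) ^ (m - 1) * n)) 0) ∧
      Maximal (HasRamanujanCongruence ℓ f)
        (arithProg ((ℓ : ℤ) ^ m) ((ℓ : ℤ) ^ (m - 1) * β)) := by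
  obtain ⟨r, rfl⟩ : ∃ r, m = r + 1 := ⟨m - 1, by omega⟩
  rw [Nat.add_sub_cancel]
  obtain ⟨k, g, G, hk, hg, hvan, n₀, hn₀⟩ := exists_congruence_modulus_prime hℓ β
  have hf := hg.pow (ℓ ^ r)
  have hcongr (n : ℤ) : CongrMod ℓ (modFourierCoeff (g.pow (ℓ ^ r)) ((ℓ : ℤ) ^ r * n)) 0 ↔
      (ℓ : ℤ) ∣ G.intCoeff n := by
    rw [hf.modFourierCoeff_eq, congrMod_intCast_zero_iff hℓ, PowerSeries.dvd_intCoeff_pow_iff hℓ]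
  have hprog (n : ℤ) : CongrMod ℓ (modFourierCoeff (g.pow (ℓ ^ r))
      ((ℓ : ℤ) ^ (r + 1) * n + (ℓ : ℤ) ^ r * β)) 0 := by
    rw [show (ℓ : ℤ) ^ (r + 1) * n + (ℓ : ℤ) ^ r * β = (ℓ : ℤ) ^ r * (ℓ * n + β) by ring, hcongr,
      PowerSeries.intCoeff]
    split_ifs with h
    · refine hvan _ ?_
      rw [Int.toNat_of_nonneg h, add_sub_cancel_right]
      exact dvd_mul_right _ _
    · exact dvd_zero _
  have hne : ¬ CongrMod ℓ (modFourierCoeff (g.pow (ℓ ^ r)) ((ℓ : ℤ) ^ r * n₀)) 0 := by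
    rw [hcongr]
    simpa [PowerSeries.intCoeff] using hn₀
  refine ⟨_, g.pow (ℓ ^ r), hk.mul_left _, fun n ↦ ?_, hprog, ⟨n₀, hne⟩,
    ⟨_, _, pow_pos (by exact_mod_cast hℓ.pos) _, rfl, hprog⟩, ?_⟩
  · rw [hf.modFourierCoeff_eq]
    exact isRatLIntegral_intCast hℓ _
  · rintro P ⟨M, β', hM, rfl, hP⟩ hle
    refine (arithProg_subset_or_of_superset hℓ r β M β' hM hle).resolve_right fun h ↦ ?_
    obtain ⟨n, hn⟩ := h n₀
    exact hne (hn ▸ hP n)
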